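/- Let $h,g,\sigma>0$ and let $\gamma\in C^{2,1}_{\mathrm{loc}}(\mathbb R)$ with $\gamma'$ bounded; write $\sup\gamma'=\sup_{\mathbb R}\gamma'$. For $\lambda\in\mathbb R$ let $\psi^\lambda$ be the unique solution of $\psi''=-\gamma(\psi)$ on $[-h,0]$, $\psi(0)=0$, $\psi'(0)=\lambda$. For $\lambda\neq0$ and $\mu\in\mathbb R$ not a Dirichlet eigenvalue of $-\partial_y^2-\gamma'(\psi^\lambda)$ on $[-h,0]$, let $\beta^{\mu,\lambda}$ be the unique solution of $$\beta''+(\gamma'(\psi^\lambda)+\mu)\beta=0\ \text{ on }[-h,0],\qquad \beta(-h)=0,\quad \beta(0)=1,$$ and put $$d(\mu,\lambda)=\beta^{\mu,\lambda}_y(0)+\sigma\lambda^{-2}\mu+\lambda^{-1}\gamma(0)-\lambda^{-2}g;$$ if $\mu$ is a Dirichlet eigenvalue of $-\partial_y^2-\gamma'(\psi^\lambda)$ on $[-h,0]$, put $d(\mu,\lambda)=\infty$. (1) If $\sup\gamma'\le\pi^2/h^2$, then for every $\lambda\ne0$ there are at most two $\mu\le0$ with $d(\mu,\lambda)=0$.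 (2) Suppose that $\lambda\neq0$, $\sup\gamma'<\pi^2/h^2$ and $$\lambda^{-2}g-\lambda^{-1}\gamma(0)<\begin{cases}\sqrt{\sup\gamma'}\cot(h\sqrt{\sup\gamma'})&\text{if }\sup\gamma'>0,\\ 1/h&\text{if }\sup\gamma'=0,\\ \sqrt{|\sup\gamma'|}\coth(h\sqrt{|\sup\gamma'|})&\text{if }\sup\gamma'<0.\end{cases}\tag{$*$}$$ Then there is precisely one $\mu_0<0$ with $d(\mu_0,\lambda)=0$. In particular, if $k_0\in\mathbb N=\{1,2,\dots\}$ and $\nu>0$ are such that $-(k_0\nu)^2=\mu_0$, then $k=k_0$ is the unique $k\in\mathbb N$ with $d(-(k\nu)^2,\lambda)=0$. (3) If $\sup\gamma'<\pi^2/(4h^2)$, then there is $\Lambda>0$ such that $(*)$ holds for all $\lambda$ with $|\lambda|\ge\Lambda$. -/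

import Mathlib

open Set
open scoped NNReal

namespace CapillaryGravity

/-! ### Classical solutions of scalar second-order equations on `[-h, 0]` -/

/-- `u` is a classical solution of `u'' = F(y, u)` on `[-h, 0]`.  Derivatives are one-sided at the
two end points, and the values of `u` outside `[-h, 0]` are irrelevant. -/
def IsClassicalSolution (h : ℝ) (F : ℝ → ℝ → ℝ) (u : ℝ → ℝ) : Prop :=
  DifferentiableOn ℝ u (Icc (-h) 0) ∧
    ∀ y ∈ Icc (-h) 0,
      HasDerivWithinAt (derivWithin u (Icc (-h) 0)) (F y (u y)) (Icc (-h) 0) y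

theorem exists_ivp_system {a b : ℝ} (hab : a ≤ b) (f : ℝ → ℝ × ℝ → ℝ × ℝ) (K : ℝ≥0)
    (hL : ∀ t ∈ Icc a b, LipschitzWith K (f t))
    (hc : ∀ x, ContinuousOn (fun t => f t x) (Icc a b)) (x₀ : ℝ × ℝ) :
    ∃ z : ℝ → ℝ × ℝ, z a = x₀ ∧
      ∀ t ∈ Icc a b, HasDerivWithinAt z (f t (z t)) (Icc a b) t := by
  obtain ⟨M, hM⟩ := isCompact_Icc.exists_bound_of_continuousOn (hc 0)
  have ha : a ∈ Icc a b := ⟨le_rfl, hab⟩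
  have hM0 : 0 ≤ M := (norm_nonneg _).trans (hM a ha)
  set R : ℝ := gronwallBound ‖x₀‖ K M (b - a) with hR
  have hmono := gronwallBound_mono (norm_nonneg x₀) hM0 K.coe_nonneg
  have hR0 : 0 ≤ R := by
    have := hmono (sub_nonneg.2 hab)
    rw [gronwallBound_x0] at this
    exact (norm_nonneg _).trans this
  let p : ℝ → ℝ := fun x => max (-R) (min R x)
  have hpL : LipschitzWith 1 p := (LipschitzWith.id.const_min R).const_max (-R)
  have hpid : ∀ x, |x| ≤ R → p x = x := by
    intro x hx
    obtain ⟨h1, h2⟩ := abs_le.1 hx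
    simp only [p]
    rw [min_eq_right h2, max_eq_right h1]
  have hpR : ∀ x, |p x| ≤ R := by
    intro x
    refine abs_le.2 ⟨le_max_left _ _, max_le (by linarith) (min_le_left _ _)⟩
  have hpx : ∀ x, |p x| ≤ |x| := by
    intro x
    have h0 : p 0 = 0 := hpid 0 (by simpa using hR0)
    have := hpL.dist_le_mul x 0
    simpa [h0, Real.dist_eq] using this
  let c : ℝ × ℝ → ℝ × ℝ := fun z => (p z.1, p z.2)
  have hcL : LipschitzWith 1 c := by
    have := (hpL.comp LipschitzWith.prod_fst).prodMk (hpL.comp LipschitzWith.prod_snd)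
      (α := ℝ × ℝ)
    simpa using this
  have hcR : ∀ z, ‖c z‖ ≤ R := fun z => max_le (hpR _) (hpR _)
  have hcz : ∀ z, ‖c z‖ ≤ ‖z‖ := fun z => max_le_max (hpx _) (hpx _)
  have hcid : ∀ z, ‖z‖ ≤ R → c z = z := fun z hz =>
    Prod.ext (hpid _ ((le_max_left _ _).trans hz)) (hpid _ ((le_max_right _ _).trans hz))
  have hgrow : ∀ t ∈ Icc a b, ∀ z, ‖f t (c z)‖ ≤ K * ‖c z‖ + M := by
    intro t ht z
    have h1 := (hL t ht).dist_le_mul (c z) 0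
    rw [dist_zero_right, dist_eq_norm] at h1
    have h2 := norm_le_norm_sub_add (f t (c z)) (f t 0)
    have h3 := hM t ht
    linarith
  let L : ℝ≥0 := ⟨K * R + M, by positivity⟩
  let A : ℝ≥0 := L * ⟨b - a, sub_nonneg.2 hab⟩
  have hPL : IsPicardLindelof (fun t z => f t (c z)) (⟨a, ha⟩ : Icc a b) x₀ A 0 L K :=
    { lipschitzOnWith := fun t ht => by
        have := ((hL t ht).comp hcL).lipschitzOnWith (s := Metric.closedBall x₀ A)
        rw [mul_one] at this
        exact this
      continuousOn := fun x _ => hc (c x)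
      norm_le := fun t ht x _ => by
        refine (hgrow t ht x).trans ?_
        change (K : ℝ) * ‖c x‖ + M ≤ K * R + M
        have := hcR x
        gcongr
      mul_max_le := by
        change (L : ℝ) * max (b - a) (a - a) ≤ (L : ℝ) * (b - a) - 0
        rw [sub_self, max_eq_left (sub_nonneg.2 hab), sub_zero] }
  obtain ⟨z, hz0, hz⟩ := hPL.exists_eq_forall_mem_Icc_hasDerivWithinAt₀
  have hz0' : z a = x₀ := hz0
  have hbd := norm_le_gronwallBound_of_norm_deriv_right_le (f := z) (f' := fun t => f t (c (z t)))
    (δ := ‖x₀‖) (K := K) (ε := M) (a := a) (b := b)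
    (fun t ht => (hz t ht).continuousWithinAt)
    (fun t ht => (hz t ⟨ht.1, ht.2.le⟩).mono_of_mem_nhdsWithin (Icc_mem_nhdsGE_of_mem ht))
    (by rw [hz0'])
    (fun t ht => by
      refine (hgrow t ⟨ht.1, ht.2.le⟩ _).trans ?_
      have := hcz (z t)
      gcongr)
  refine ⟨z, hz0', fun t ht => ?_⟩
  have h1 : ‖z t‖ ≤ R := (hbd t ht).trans (hmono (by linarith [ht.2]))
  have h2 := hz t ht
  simp only [hcid _ h1] at h2
  exact h2

theorem exists_ivp_pair {a b : ℝ} (hab : a ≤ b) (F : ℝ → ℝ → ℝ) (K : ℝ≥0)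
    (hL : ∀ t ∈ Icc a b, LipschitzWith K (F t))
    (hc : ∀ x, ContinuousOn (fun t => F t x) (Icc a b)) (u₀ v₀ : ℝ) :
    ∃ u v : ℝ → ℝ, u a = u₀ ∧ v a = v₀ ∧
      ∀ t ∈ Icc a b, HasDerivWithinAt u (v t) (Icc a b) t ∧
        HasDerivWithinAt v (F t (u t)) (Icc a b) t := by
  obtain ⟨z, hz0, hz⟩ := exists_ivp_system hab (fun t z => (z.2, F t z.1)) (max 1 (K * 1))
    (fun t ht => LipschitzWith.prod_snd.prodMk ((hL t ht).comp LipschitzWith.prod_fst))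
    (fun x => continuousOn_const.prodMk (hc x.1)) (u₀, v₀)
  refine ⟨fun t => (z t).1, fun t => (z t).2, by simp [hz0], by simp [hz0], fun t ht => ?_⟩
  exact ⟨(hz t ht).fst, (hz t ht).snd⟩

theorem isClassicalSolution_of_pair {h : ℝ} (hh : 0 < h) {F : ℝ → ℝ → ℝ} {u v : ℝ → ℝ}
    (H : ∀ t ∈ Icc (-h) 0, HasDerivWithinAt u (v t) (Icc (-h) 0) t ∧
        HasDerivWithinAt v (F t (u t)) (Icc (-h) 0) t) :
    IsClassicalSolution h F u ∧ ∀ t ∈ Icc (-h) 0, derivWithin u (Icc (-h) 0) t = v t := by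
  have hu : UniqueDiffOn ℝ (Icc (-h) 0) := uniqueDiffOn_Icc (by linarith)
  have hd : ∀ t ∈ Icc (-h) 0, derivWithin u (Icc (-h) 0) t = v t := fun t ht =>
    (H t ht).1.derivWithin (hu t ht)
  exact ⟨⟨fun t ht => (H t ht).1.differentiableWithinAt,
    fun t ht => (H t ht).2.congr hd (hd t ht)⟩, hd⟩

/-! ### The vorticity function and the trivial (laminar) solutions -/

/-- Vorticity functions: `γ ∈ C^{2,1}_loc(ℝ)` with `γ'` bounded. -/
structure IsVorticityFunction (γ : ℝ → ℝ) : Prop where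
  contDiff : ContDiff ℝ 2 γ
  locallyLipschitz : LocallyLipschitz (deriv (deriv γ))
  bounded_deriv : ∃ M : ℝ, ∀ t, |deriv γ t| ≤ M

/-- `ψ` solves `ψ'' = -γ(ψ)` on `[-h, 0]`, `ψ(0) = 0`, `ψ'(0) = lam`. -/
def IsTrivialSolution (γ : ℝ → ℝ) (h lam : ℝ) (ψ : ℝ → ℝ) : Prop :=
  IsClassicalSolution h (fun _ s => -γ s) ψ ∧ ψ 0 = 0 ∧ derivWithin ψ (Icc (-h) 0) 0 = lam

/-- The trivial solution `ψ^lam`: the solution of the Cauchy problem `IsTrivialSolution`, which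
exists (`trivialSolution_spec`) and is unique on `[-h, 0]` (`IsTrivialSolution.eqOn`). -/
noncomputable def trivialSolution (γ : ℝ → ℝ) (h lam : ℝ) : ℝ → ℝ :=
  Classical.epsilon (IsTrivialSolution γ h lam)

theorem IsVorticityFunction.lipschitz {γ : ℝ → ℝ} (hγ : IsVorticityFunction γ) :
    ∃ K : ℝ≥0, LipschitzWith K (fun s => -γ s) := by
  obtain ⟨M, hM⟩ := hγ.bounded_deriv
  have hM0 : 0 ≤ M := (abs_nonneg _).trans (hM 0)
  refine ⟨⟨M, hM0⟩, LipschitzWith.neg (f := γ) ?_⟩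
  exact lipschitzWith_of_nnnorm_deriv_le (hγ.contDiff.differentiable (by norm_num))
    (fun x => hM x)

theorem trivialSolution_spec {γ : ℝ → ℝ} (hγ : IsVorticityFunction γ) {h : ℝ} (hh : 0 < h)
    (lam : ℝ) : IsTrivialSolution γ h lam (trivialSolution γ h lam) := by
  obtain ⟨K, hK⟩ := hγ.lipschitz
  apply Classical.epsilon_spec (p := IsTrivialSolution γ h lam)
  obtain ⟨u, v, hu0, hv0, H⟩ := exists_ivp_pair hh.le (fun _ s => -γ s) K
    (fun _ _ => hK) (fun _ => continuousOn_const) 0 (-lam)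
  have hmaps : MapsTo (fun y : ℝ => -y) (Icc (-h) 0) (Icc 0 h) := fun y hy =>
    ⟨by linarith [hy.2], by linarith [hy.1]⟩
  have H' : ∀ t ∈ Icc (-h) 0,
      HasDerivWithinAt (fun y => u (-y)) (-v (-t)) (Icc (-h) 0) t ∧
        HasDerivWithinAt (fun y => -v (-y)) (-γ (u (-t))) (Icc (-h) 0) t := by
    intro t ht
    have hn : HasDerivWithinAt (fun y : ℝ => -y) (-1) (Icc (-h) 0) t :=
      (hasDerivAt_neg t).hasDerivWithinAt
    obtain ⟨h1, h2⟩ := H (-t) (hmaps ht)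
    have h3 := h1.comp t hn hmaps
    have h4 := (h2.comp t hn hmaps).neg
    rw [mul_neg_one] at h3
    rw [mul_neg_one, neg_neg] at h4
    exact ⟨h3, h4⟩
  obtain ⟨hs, hd⟩ := isClassicalSolution_of_pair hh (F := fun _ s => -γ s) H'
  refine ⟨_, hs, by simpa using hu0, ?_⟩
  rw [hd 0 ⟨by linarith, le_rfl⟩]
  simp [hv0]

theorem IsTrivialSolution.eqOn {γ : ℝ → ℝ} (hγ : IsVorticityFunction γ) {h lam : ℝ}
    {ψ₁ ψ₂ : ℝ → ℝ} (h₁ : IsTrivialSolution γ h lam ψ₁) (h₂ : IsTrivialSolution γ h lam ψ₂) :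
    EqOn ψ₁ ψ₂ (Icc (-h) 0) := by
  obtain ⟨K, hK⟩ := hγ.lipschitz
  have key : ∀ ψ, IsTrivialSolution γ h lam ψ →
      ContinuousOn (fun t => (ψ t, derivWithin ψ (Icc (-h) 0) t)) (Icc (-h) 0) ∧
      ∀ t ∈ Ioc (-h) 0, HasDerivWithinAt (fun t => (ψ t, derivWithin ψ (Icc (-h) 0) t))
        (derivWithin ψ (Icc (-h) 0) t, -γ (ψ t)) (Iic t) t := by
    intro ψ hψ
    have hd : ∀ t ∈ Icc (-h) 0, HasDerivWithinAt (fun t => (ψ t, derivWithin ψ (Icc (-h) 0) t))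
        (derivWithin ψ (Icc (-h) 0) t, -γ (ψ t)) (Icc (-h) 0) t := fun t ht =>
      ((hψ.1.1 t ht).hasDerivWithinAt).prodMk (hψ.1.2 t ht)
    exact ⟨fun t ht => (hd t ht).continuousWithinAt, fun t ht =>
      (hd t ⟨ht.1.le, ht.2⟩).mono_of_mem_nhdsWithin (Icc_mem_nhdsLE_of_mem ht)⟩
  have := ODE_solution_unique_of_mem_Icc_left
    (v := fun _ (z : ℝ × ℝ) => (z.2, -γ z.1)) (s := fun _ => univ) (K := max 1 (K * 1))
    (fun t _ => (LipschitzWith.prod_snd.prodMk (hK.comp LipschitzWith.prod_fst)).lipschitzOnWith)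
    (key ψ₁ h₁).1 (key ψ₁ h₁).2 (fun _ _ => mem_univ _)
    (key ψ₂ h₂).1 (key ψ₂ h₂).2 (fun _ _ => mem_univ _)
    (Prod.ext (h₁.2.1.trans h₂.2.1.symm) (h₁.2.2.trans h₂.2.2.symm))
  exact fun t ht => congrArg Prod.fst (this ht)

/-! ### The linearised problem and the dispersion relation -/

/-- `u'' + (γ'(ψ^lam) + μ) u = 0` on `[-h, 0]`. -/
def SolvesLinearised (γ : ℝ → ℝ) (h lam μ : ℝ) (u : ℝ → ℝ) : Prop :=
  IsClassicalSolution h (fun y s => -((deriv γ (trivialSolution γ h lam y) + μ) * s)) u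

/-- The (real) Dirichlet spectrum of `-∂_y² - γ'(ψ^lam)` on `[-h, 0]`, i.e. the set of its
Dirichlet eigenvalues. -/
def dirichletSpectrum (γ : ℝ → ℝ) (h lam : ℝ) : Set ℝ :=
  {μ | ∃ u : ℝ → ℝ, SolvesLinearised γ h lam μ u ∧ u (-h) = 0 ∧ u 0 = 0 ∧
    ∃ y ∈ Icc (-h) 0, u y ≠ 0}

/-- `β'' + (γ'(ψ^lam) + μ) β = 0` on `[-h, 0]`, `β(-h) = 0`, `β(0) = 1`. -/
def IsBeta (γ : ℝ → ℝ) (h lam μ : ℝ) (β : ℝ → ℝ) : Prop :=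
  SolvesLinearised γ h lam μ β ∧ β (-h) = 0 ∧ β 0 = 1

/-- The function `β^{μ,lam}`.  If `μ` is not in the Dirichlet spectrum, the boundary value problem
`IsBeta` has a solution (`beta_spec`), and only one on `[-h, 0]` (`IsBeta.eqOn`); otherwise
this is not used. -/
noncomputable def beta (γ : ℝ → ℝ) (h lam μ : ℝ) : ℝ → ℝ :=
  Classical.epsilon (IsBeta γ h lam μ)

theorem IsClassicalSolution.linearComb {h : ℝ} (hh : 0 < h) {q : ℝ → ℝ} {u v : ℝ → ℝ}
    (hu : IsClassicalSolution h (fun y s => -(q y * s)) u)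
    (hv : IsClassicalSolution h (fun y s => -(q y * s)) v) (c d : ℝ) :
    IsClassicalSolution h (fun y s => -(q y * s)) (fun y => c * u y + d * v y) := by
  refine (isClassicalSolution_of_pair hh (v := fun y =>
    c * derivWithin u (Icc (-h) 0) y + d * derivWithin v (Icc (-h) 0) y) fun t ht => ⟨?_, ?_⟩).1
  · exact ((hu.1 t ht).hasDerivWithinAt.const_mul c).add ((hv.1 t ht).hasDerivWithinAt.const_mul d)
  · have := ((hu.2 t ht).const_mul c).add ((hv.2 t ht).const_mul d)
    have he : -(q t * (c * u t + d * v t)) = c * -(q t * u t) + d * -(q t * v t) := by ring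
    rw [he]
    exact this

theorem beta_spec {γ : ℝ → ℝ} (hγ : IsVorticityFunction γ) {h : ℝ} (hh : 0 < h) {lam μ : ℝ}
    (hμ : μ ∉ dirichletSpectrum γ h lam) : IsBeta γ h lam μ (beta γ h lam μ) := by
  apply Classical.epsilon_spec (p := IsBeta γ h lam μ)
  set q : ℝ → ℝ := fun y => deriv γ (trivialSolution γ h lam y) + μ with hq
  have hqc : ContinuousOn q (Icc (-h) 0) := by
    have h1 : Continuous (deriv γ) := hγ.contDiff.continuous_deriv (by norm_num)
    have h2 : ContinuousOn (trivialSolution γ h lam) (Icc (-h) 0) :=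
      (trivialSolution_spec hγ hh lam).1.1.continuousOn
    exact (h1.comp_continuousOn h2).add continuousOn_const
  obtain ⟨M, hM⟩ := isCompact_Icc.exists_bound_of_continuousOn hqc
  have hM0 : 0 ≤ M := (norm_nonneg _).trans (hM 0 ⟨by linarith, le_rfl⟩)
  obtain ⟨u, v, hu0, hv0, H⟩ := exists_ivp_pair (a := -h) (b := 0) (by linarith)
    (fun y s => -(q y * s)) ⟨M, hM0⟩
    (fun t ht => LipschitzWith.of_dist_le_mul fun x y => by
      rw [Real.dist_eq, Real.dist_eq]
      have : -(q t * x) - -(q t * y) = -(q t * (x - y)) := by ring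
      rw [this, abs_neg, abs_mul]
      exact mul_le_mul_of_nonneg_right (hM t ht) (abs_nonneg _))
    (fun x => (hqc.mul continuousOn_const).neg) 0 1
  obtain ⟨hs, hd⟩ := isClassicalSolution_of_pair hh (F := fun y s => -(q y * s)) H
  have hm : -h ∈ Icc (-h) 0 := ⟨le_rfl, by linarith⟩
  have hne : u 0 ≠ 0 := by
    intro h0
    refine hμ ⟨u, hs, hu0, h0, ?_⟩
    by_contra! hcon
    have h1 : HasDerivWithinAt u 0 (Icc (-h) 0) (-h) :=
      (hasDerivWithinAt_const _ _ (0 : ℝ)).congr hcon (hcon _ hm)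
    have h2 := h1.derivWithin (uniqueDiffOn_Icc (by linarith : -h < 0) _ hm)
    rw [hd _ hm, hv0] at h2
    exact one_ne_zero h2
  refine ⟨fun y => (u 0)⁻¹ * u y + 0 * u y, hs.linearComb hh hs _ _, by simp [hu0], ?_⟩
  simp [hne]

theorem IsBeta.eqOn {γ : ℝ → ℝ} {h : ℝ} (hh : 0 < h) {lam μ : ℝ}
    (hμ : μ ∉ dirichletSpectrum γ h lam) {β₁ β₂ : ℝ → ℝ}
    (h₁ : IsBeta γ h lam μ β₁) (h₂ : IsBeta γ h lam μ β₂) : EqOn β₁ β₂ (Icc (-h) 0) := by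
  intro y hy
  by_contra hne
  refine hμ ⟨fun y => 1 * β₁ y + (-1) * β₂ y, h₁.1.linearComb hh h₂.1 _ _, ?_, ?_, y, hy, ?_⟩
  · simp [h₁.2.1, h₂.2.1]
  · simp [h₁.2.2, h₂.2.2]
  · intro h0
    apply hne
    linarith

open Classical in
/-- The dispersion function
`d(μ, lam) = β_y^{μ,lam}(0) + σ lam⁻² μ + lam⁻¹ γ(0) - lam⁻² g`,
with `d(μ, lam) = ∞` if `μ` is in the Dirichlet spectrum of `-∂_y² - γ'(ψ^lam)`. -/
noncomputable def dispersion (γ : ℝ → ℝ) (h g σ μ lam : ℝ) : WithTop ℝ :=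
  if μ ∈ dirichletSpectrum γ h lam then ⊤
  else ((derivWithin (beta γ h lam μ) (Icc (-h) 0) 0
    + σ * (lam ^ 2)⁻¹ * μ + lam⁻¹ * γ 0 - (lam ^ 2)⁻¹ * g : ℝ) : WithTop ℝ)

/-- The explicit threshold, as a function of `s = sup γ'`. -/
noncomputable def threshold (h s : ℝ) : ℝ :=
  if 0 < s then √s * Real.cot (h * √s)
  else if s = 0 then 1 / h
  else √|s| * (Real.cosh (h * √|s|) / Real.sinh (h * √|s|))

end CapillaryGravity

namespace CapillaryGravity

/-! ### Energy identities -/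

/-! The slope `β_y(0)` is a minimum of affine functions of `μ`. Let `E(u) = ∫ (u'² - γ'(ψ)u²)`. If
`u(-h) = 0` and `u(0) = 1`, integration by parts gives `E(u) - μ∫u² = β_y(0) + R`, where `R` is the
energy of `u - β` for the potential `γ'(ψ) + μ`. Since `u - β` vanishes at both ends, Wirtinger's
inequality gives `R ≥ (π²/h² - sup γ' - μ)∫(u - β)²`, which is nonnegative for `μ ≤ 0`
(`betaSlope_le_energy`), and `u = β` gives equality. Hence the slope is concave in `μ ≤ 0`, strictly
so because different `μ` have different `β` (`betaSlope_strictConcave`). The remaining terms of `d`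
are affine in `μ`, so `d` has at most two zeros there.

For (2), comparison with the constant potential `sup γ'`, whose explicit solution has slope
`threshold`, gives `d(0) > 0`. Test functions of small `L²` norm show that the slope is at most `C -
εμ` for every `ε > 0`, so the term `σμ/lam²` makes `d` negative far to the left. A strictly concave
function with these signs has exactly one negative zero. For (3), `threshold` is positive and the
left side of the condition tends to `0` as `|lam| → ∞`. -/

/-- On `[-h, 0]`, the function `u` is continuously differentiable with derivative `u'`. -/
structure HasContDerivOn (h : ℝ) (u u' : ℝ → ℝ) : Prop where
  deriv : ∀ t ∈ Icc (-h) 0, HasDerivWithinAt u (u' t) (Icc (-h) 0) t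
  cont : ContinuousOn u' (Icc (-h) 0)

theorem HasContDerivOn.continuousOn {h : ℝ} {u u' : ℝ → ℝ} (hu : HasContDerivOn h u u') :
    ContinuousOn u (Icc (-h) 0) := fun t ht => (hu.deriv t ht).continuousWithinAt

theorem HasContDerivOn.sub {h : ℝ} {u u' v v' : ℝ → ℝ} (hu : HasContDerivOn h u u')
    (hv : HasContDerivOn h v v') :
    HasContDerivOn h (fun y => u y - v y) (fun y => u' y - v' y) :=
  ⟨fun t ht => (hu.deriv t ht).sub (hv.deriv t ht), hu.cont.sub hv.cont⟩

theorem intervalIntegrable_of_continuousOn {h : ℝ} (hh : 0 < h) {f : ℝ → ℝ}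
    (hf : ContinuousOn f (Icc (-h) 0)) :
    IntervalIntegrable f MeasureTheory.volume (-h) 0 :=
  hf.intervalIntegrable_of_Icc (by linarith)

theorem HasContDerivOn.integral_eq {h : ℝ} (hh : 0 < h) {u u' : ℝ → ℝ}
    (hu : HasContDerivOn h u u') : ∫ y in (-h)..0, u' y = u 0 - u (-h) :=
  intervalIntegral.integral_eq_sub_of_hasDerivAt_of_le (by linarith) hu.continuousOn
    (fun t ht => (hu.deriv t ⟨ht.1.le, ht.2.le⟩).hasDerivAt (Icc_mem_nhds ht.1 ht.2))
    (intervalIntegrable_of_continuousOn hh hu.cont)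

/-- The quadratic form `∫ (u'² - p u²)` of the operator `-∂_y² - p` on `[-h, 0]`. -/
noncomputable def energy (h : ℝ) (p u u' : ℝ → ℝ) : ℝ :=
  ∫ y in (-h)..0, (u' y ^ 2 - p y * u y ^ 2)

theorem HasContDerivOn.energy_mono {h : ℝ} (hh : 0 < h) {p q u u' : ℝ → ℝ}
    (hp : ContinuousOn p (Icc (-h) 0)) (hq : ContinuousOn q (Icc (-h) 0))
    (hu : HasContDerivOn h u u') (hpq : ∀ y ∈ Icc (-h) 0, p y ≤ q y) :
    energy h q u u' ≤ energy h p u u' := by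
  have hc := hu.continuousOn
  have hc' := hu.cont
  refine intervalIntegral.integral_mono_on (by linarith)
    (intervalIntegrable_of_continuousOn hh (by fun_prop))
    (intervalIntegrable_of_continuousOn hh (by fun_prop)) fun y hy => ?_
  have := mul_le_mul_of_nonneg_right (hpq y hy) (sq_nonneg (u y))
  linarith

theorem HasContDerivOn.energy_add_const {h : ℝ} (hh : 0 < h) {p u u' : ℝ → ℝ}
    (hp : ContinuousOn p (Icc (-h) 0)) (hu : HasContDerivOn h u u') (c : ℝ) :
    energy h (fun y => p y + c) u u' = energy h p u u' - c * ∫ y in (-h)..0, u y ^ 2 := by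
  have hc := hu.continuousOn
  have hc' := hu.cont
  unfold energy
  rw [← intervalIntegral.integral_const_mul, ← intervalIntegral.integral_sub
    (intervalIntegrable_of_continuousOn hh (by fun_prop))
    (intervalIntegrable_of_continuousOn hh (by fun_prop))]
  congr 1
  ext y
  ring

/-! ### Wirtinger's inequality and coercivity of the energy. -/

/-- Completing the square with a solution `ρ` of the Riccati equation `ρ' + ρ² = -κ²`. -/
theorem HasContDerivOn.energy_const_nonneg_of_lt {h : ℝ} (hh : 0 < h) {u u' : ℝ → ℝ}
    (hu : HasContDerivOn h u u') (h1 : u (-h) = 0) (h0 : u 0 = 0) {κ : ℝ} (hκ : 0 < κ)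
    (hκh : κ * h < Real.pi) : 0 ≤ energy h (fun _ => κ ^ 2) u u' := by
  have hcos : ∀ y ∈ Icc (-h) 0, Real.cos (κ * (y + h / 2)) ≠ 0 := by
    intro y hy
    have e1 : κ * (y + h / 2) ≤ κ * (h / 2) := by gcongr; linarith [hy.2]
    have e2 : κ * (-(h / 2)) ≤ κ * (y + h / 2) := by gcongr; linarith [hy.1]
    exact (Real.cos_pos_of_mem_Ioo ⟨by linarith, by linarith⟩).ne'
  -- Then `u'² - κ²u² = (u' - ρu)² + (ρu²)'`, and the last term integrates to zero. Centring the
  -- tangent at the midpoint `-h/2` keeps it finite on all of `[-h, 0]` exactly because `κh < π`.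
  set ρ : ℝ → ℝ := fun y => -(κ * Real.tan (κ * (y + h / 2))) with hρ
  have hρd : ∀ y ∈ Icc (-h) 0, HasDerivWithinAt ρ (-κ ^ 2 - ρ y ^ 2) (Icc (-h) 0) y := by
    intro y hy
    have e1 : HasDerivAt (fun y : ℝ => κ * (y + h / 2)) (κ * 1) y :=
      ((hasDerivAt_id y).add_const _).const_mul κ
    have e2 := (((Real.hasDerivAt_tan (hcos y hy)).comp y e1).const_mul κ).neg
    refine e2.hasDerivWithinAt.congr_deriv ?_
    simp only [hρ, Real.tan_eq_sin_div_cos]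
    have := hcos y hy
    generalize κ * (y + h / 2) = θ at this ⊢
    field_simp
    linarith [Real.sin_sq_add_cos_sq θ]
  have hρc : ContinuousOn ρ (Icc (-h) 0) := fun y hy => (hρd y hy).continuousWithinAt
  have hc := hu.continuousOn
  have hc' := hu.cont
  have hF : HasContDerivOn h (fun y => ρ y * u y ^ 2)
      (fun y => (-κ ^ 2 - ρ y ^ 2) * u y ^ 2 + ρ y * (2 * u y * u' y)) := by
    refine ⟨fun t ht => ?_, by fun_prop⟩
    have := (hρd t ht).mul ((hu.deriv t ht).pow 2)
    refine this.congr_deriv ?_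
    simp
  have hI := hF.integral_eq hh
  simp only [h1, h0] at hI
  have hle : ∫ y in (-h)..0, ((-κ ^ 2 - ρ y ^ 2) * u y ^ 2 + ρ y * (2 * u y * u' y)) ≤
      energy h (fun _ => κ ^ 2) u u' := by
    refine intervalIntegral.integral_mono_on (by linarith)
      (intervalIntegrable_of_continuousOn hh hF.cont)
      (intervalIntegrable_of_continuousOn hh (by fun_prop)) fun y hy => ?_
    linarith [sq_nonneg (u' y - ρ y * u y)]
  linarith

theorem energy_const {h : ℝ} (hh : 0 < h) {u u' : ℝ → ℝ} (hu : HasContDerivOn h u u') (c : ℝ) :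
    energy h (fun _ => c) u u' = energy h 0 u u' - c * ∫ y in (-h)..0, u y ^ 2 := by
  rw [← hu.energy_add_const hh (p := 0) continuousOn_const]
  simp

/-- Wirtinger's inequality. -/
theorem HasContDerivOn.energy_const_nonneg {h : ℝ} (hh : 0 < h) {u u' : ℝ → ℝ}
    (hu : HasContDerivOn h u u') (h1 : u (-h) = 0) (h0 : u 0 = 0) :
    0 ≤ energy h (fun _ => Real.pi ^ 2 / h ^ 2) u u' := by
  have hpi := Real.pi_pos
  have hpos : 0 < Real.pi / h := by positivity
  -- At `κ = π/h` the tangent blows up at both ends, so this case is reached as a limit: the energy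
  -- is continuous in `κ`.
  have hcl : Real.pi / h ∈ closure (Ioo 0 (Real.pi / h)) := by
    rw [closure_Ioo hpos.ne]
    exact ⟨hpos.le, le_rfl⟩
  have hclosed : IsClosed {κ : ℝ | 0 ≤ energy h (fun _ => κ ^ 2) u u'} := by
    simp only [energy_const hh hu]
    exact isClosed_le continuous_const (by fun_prop)
  have := closure_minimal (t := {κ : ℝ | 0 ≤ energy h (fun _ => κ ^ 2) u u'})
    (fun κ hκ => hu.energy_const_nonneg_of_lt hh h1 h0 hκ.1
      ((lt_div_iff₀ hh).1 hκ.2)) hclosed hcl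
  simpa [div_pow] using this

/-- Raising the potential to the constant `c` only lowers the energy, and Wirtinger's inequality
handles the constant. Keeping the surplus multiple of `∫u²` is what later yields strict
inequalities. -/
theorem HasContDerivOn.le_energy {h : ℝ} (hh : 0 < h) {p u u' : ℝ → ℝ}
    (hp : ContinuousOn p (Icc (-h) 0)) (hu : HasContDerivOn h u u') (h1 : u (-h) = 0)
    (h0 : u 0 = 0) {c : ℝ} (hpc : ∀ y ∈ Icc (-h) 0, p y ≤ c) :
    (Real.pi ^ 2 / h ^ 2 - c) * (∫ y in (-h)..0, u y ^ 2) ≤ energy h p u u' := by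
  have e1 := hu.energy_mono hh hp continuousOn_const hpc
  have e2 := hu.energy_const_nonneg hh h1 h0
  rw [energy_const hh hu] at e1 e2
  linarith

theorem integral_sq_nonneg {h : ℝ} (hh : 0 < h) (u : ℝ → ℝ) :
    0 ≤ ∫ y in (-h)..0, u y ^ 2 :=
  intervalIntegral.integral_nonneg (by linarith) fun _ _ => sq_nonneg _

theorem integral_sq_pos {h : ℝ} (hh : 0 < h) {u : ℝ → ℝ} (hu : ContinuousOn u (Icc (-h) 0))
    (hne : ∃ y ∈ Icc (-h) 0, u y ≠ 0) : 0 < ∫ y in (-h)..0, u y ^ 2 := by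
  obtain ⟨y, hy, hy0⟩ := hne
  exact intervalIntegral.integral_pos (by linarith) (hu.pow 2) (fun _ _ => sq_nonneg _)
    ⟨y, hy, by positivity⟩

/-! ### Variational identity and comparison of slopes. -/

/-- For a solution `b` of `b'' = -p b` and any `u` with the same boundary values,
the energy of `u` exceeds the boundary term `[b' b]` by the energy of `u - b`. -/
theorem energy_eq_add_energy_sub {h : ℝ} (hh : 0 < h) {p b b' u u' : ℝ → ℝ}
    (hp : ContinuousOn p (Icc (-h) 0)) (hb : HasContDerivOn h b b')
    (hb' : HasContDerivOn h b' (fun y => -(p y * b y))) (hu : HasContDerivOn h u u')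
    (h1 : u (-h) = b (-h)) (h0 : u 0 = b 0) :
    energy h p u u' = b' 0 * b 0 - b' (-h) * b (-h)
      + energy h p (fun y => u y - b y) (fun y => u' y - b' y) := by
  have c1 := hb.continuousOn
  have c2 := hb.cont
  have c3 := hu.continuousOn
  have c4 := hu.cont
  -- The difference of the two energy densities is the exact derivative of `b'(2u - b)`, because
  -- `b'' = -pb`.
  have hF : HasContDerivOn h (fun y => b' y * (2 * u y - b y))
      (fun y => -(p y * b y) * (2 * u y - b y) + b' y * (2 * u' y - b' y)) :=
    ⟨fun t ht => (hb'.deriv t ht).mul (((hu.deriv t ht).const_mul 2).sub (hb.deriv t ht)),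
      by fun_prop⟩
  have hI := hF.integral_eq hh
  rw [h1, h0] at hI
  have e : energy h p u u' - energy h p (fun y => u y - b y) (fun y => u' y - b' y) =
      ∫ y in (-h)..0, (-(p y * b y) * (2 * u y - b y) + b' y * (2 * u' y - b' y)) := by
    unfold energy
    rw [← intervalIntegral.integral_sub
      (intervalIntegrable_of_continuousOn hh (by fun_prop))
      (intervalIntegrable_of_continuousOn hh (by fun_prop))]
    congr 1
    ext y
    ring
  linarith

theorem energy_eq_of_solution {h : ℝ} (hh : 0 < h) {p b b' : ℝ → ℝ}
    (hp : ContinuousOn p (Icc (-h) 0)) (hb : HasContDerivOn h b b')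
    (hb' : HasContDerivOn h b' (fun y => -(p y * b y))) :
    energy h p b b' = b' 0 * b 0 - b' (-h) * b (-h) := by
  have := energy_eq_add_energy_sub hh hp hb hb' hb rfl rfl
  simpa [energy] using this

/-- Comparison of slopes: `u'(0) ≤ b'(0)` if `b'' = -p b`, `u'' = -s u` and `p ≤ s ≤ π²/h²`. -/
theorem comparison_le {h : ℝ} (hh : 0 < h) {p b b' u u' : ℝ → ℝ} {s : ℝ}
    (hp : ContinuousOn p (Icc (-h) 0)) (hps : ∀ y ∈ Icc (-h) 0, p y ≤ s)
    (hs : s ≤ Real.pi ^ 2 / h ^ 2)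
    (hb : HasContDerivOn h b b') (hb' : HasContDerivOn h b' (fun y => -(p y * b y)))
    (b1 : b (-h) = 0) (b0 : b 0 = 1)
    (hu : HasContDerivOn h u u') (hu' : HasContDerivOn h u' (fun y => -(s * u y)))
    (u1 : u (-h) = 0) (u0 : u 0 = 1) : u' 0 ≤ b' 0 := by
  -- With energies indexed by their potentials: `b'(0) = E_p(b) ≥ E_s(b) = u'(0) + E_s(b - u) ≥
  -- u'(0)`.
  have e1 := energy_eq_of_solution hh hp hb hb'
  have e2 := energy_eq_add_energy_sub hh (p := fun _ => s) continuousOn_const hu hu' hb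
    (by rw [b1, u1]) (by rw [b0, u0])
  have e3 := hb.energy_mono hh hp continuousOn_const hps
  have e4 := (hb.sub hu).le_energy hh (p := fun _ => s) continuousOn_const
    (by simp [b1, u1]) (by simp [b0, u0]) (fun _ _ => le_rfl)
  have e5 := mul_nonneg (sub_nonneg.2 hs) (integral_sq_nonneg hh (fun y => b y - u y))
  rw [b0, b1] at e1
  rw [u0, u1] at e2
  linarith

/-! ### Explicit solutions for constant potentials, and the threshold. -/

theorem hasContDerivOn_of_hasDerivAt {h : ℝ} {u u' : ℝ → ℝ} (hu : ∀ t, HasDerivAt u (u' t) t)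
    (hc : Continuous u') : HasContDerivOn h u u' :=
  ⟨fun t _ => (hu t).hasDerivWithinAt, hc.continuousOn⟩

/-- `threshold h s` is the slope at `0` of the solution of `u'' = -su` with the same boundary
values: a normalised sine, line or hyperbolic sine of `y + h`. The strict bound on `s` keeps
`sin(h√s)` nonzero. -/
theorem threshold_le {h : ℝ} (hh : 0 < h) {p b b' : ℝ → ℝ} {s : ℝ}
    (hp : ContinuousOn p (Icc (-h) 0)) (hps : ∀ y ∈ Icc (-h) 0, p y ≤ s)
    (hs : s < Real.pi ^ 2 / h ^ 2)
    (hb : HasContDerivOn h b b') (hb' : HasContDerivOn h b' (fun y => -(p y * b y)))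
    (b1 : b (-h) = 0) (b0 : b 0 = 1) : threshold h s ≤ b' 0 := by
  unfold threshold
  have hlin : ∀ κ t : ℝ, HasDerivAt (fun y => κ * (y + h)) κ t := fun κ t => by
    simpa using ((hasDerivAt_id t).add_const h).const_mul κ
  split_ifs with h1 h2
  · set κ := √s with hκ
    have hκ2 : κ ^ 2 = s := Real.sq_sqrt h1.le
    have hκ0 : 0 < κ := Real.sqrt_pos.2 h1
    have hlt : h * κ < Real.pi := by
      have : κ < Real.pi / h := by
        refine (Real.sqrt_lt' (by positivity)).2 ?_
        rwa [div_pow]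
      rw [mul_comm]
      exact (lt_div_iff₀ hh).1 this
    have hsin : Real.sin (h * κ) ≠ 0 := (Real.sin_pos_of_pos_of_lt_pi (by positivity) hlt).ne'
    have := comparison_le hh hp hps hs.le hb hb' b1 b0
      (u := fun y => Real.sin (κ * (y + h)) / Real.sin (h * κ))
      (u' := fun y => Real.cos (κ * (y + h)) * κ / Real.sin (h * κ))
      (hasContDerivOn_of_hasDerivAt (fun t => (hlin κ t).sin.div_const _) (by fun_prop))
      (hasContDerivOn_of_hasDerivAt (fun t => by
        refine (((hlin κ t).cos.mul_const κ).div_const (Real.sin (h * κ))).congr_deriv ?_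
        rw [← hκ2]; ring) (by fun_prop))
      (by simp) (by simp [mul_comm κ h, hsin])
    rw [Real.cot_eq_cos_div_sin]
    convert this using 1
    rw [zero_add, mul_comm κ h]
    ring
  · subst h2
    have := comparison_le hh hp hps hs.le hb hb' b1 b0
      (u := fun y => (1 / h) * (y + h)) (u' := fun y => 1 / h)
      (hasContDerivOn_of_hasDerivAt (hlin (1 / h)) (by fun_prop))
      (hasContDerivOn_of_hasDerivAt (fun t => by
        simpa using hasDerivAt_const t (1 / h)) (by fun_prop))
      (by simp) (by simp [hh.ne'])
    exact this
  · have h3 : s < 0 := lt_of_le_of_ne (not_lt.1 h1) h2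
    set κ := √|s| with hκ
    have hκ2 : κ ^ 2 = -s := by rw [hκ, Real.sq_sqrt (abs_nonneg s), abs_of_neg h3]
    have hκ0 : 0 < κ := Real.sqrt_pos.2 (abs_pos.2 h2)
    have hsin : Real.sinh (h * κ) ≠ 0 := (Real.sinh_pos_iff.2 (by positivity)).ne'
    have := comparison_le hh hp hps hs.le hb hb' b1 b0
      (u := fun y => Real.sinh (κ * (y + h)) / Real.sinh (h * κ))
      (u' := fun y => Real.cosh (κ * (y + h)) * κ / Real.sinh (h * κ))
      (hasContDerivOn_of_hasDerivAt (fun t => (hlin κ t).sinh.div_const _) (by fun_prop))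
      (hasContDerivOn_of_hasDerivAt (fun t => by
        refine (((hlin κ t).cosh.mul_const κ).div_const (Real.sinh (h * κ))).congr_deriv ?_
        rw [show s = -κ ^ 2 by linarith]; ring) (by fun_prop))
      (by simp) (by simp [mul_comm κ h, hsin])
    convert this using 1
    rw [zero_add, mul_comm κ h]
    ring

/-- Only the cotangent could fail to be positive, and here `h√s < π/2`. -/
theorem threshold_pos {h s : ℝ} (hh : 0 < h) (hs : s < Real.pi ^ 2 / (4 * h ^ 2)) :
    0 < threshold h s := by
  unfold threshold
  split_ifs with h1 h2
  · have hκ0 : 0 < √s := Real.sqrt_pos.2 h1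
    have hlt : √s < Real.pi / (2 * h) := by
      have := Real.pi_pos
      refine (Real.sqrt_lt' (by positivity)).2 (hs.trans_eq ?_)
      rw [div_pow]
      ring
    have hlt' : h * √s < Real.pi / 2 := by
      rw [lt_div_iff₀ (by positivity)] at hlt
      linarith
    have hpos : 0 < h * √s := by positivity
    rw [Real.cot_eq_cos_div_sin]
    have e1 := Real.cos_pos_of_mem_Ioo (x := h * √s) ⟨by linarith, hlt'⟩
    have e2 := Real.sin_pos_of_pos_of_lt_pi hpos (by linarith)
    positivity
  · positivity
  · have hκ0 : 0 < √|s| := Real.sqrt_pos.2 (abs_pos.2 h2)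
    have e1 := Real.cosh_pos (h * √|s|)
    have e2 : 0 < Real.sinh (h * √|s|) := Real.sinh_pos_iff.2 (by positivity)
    positivity

/-! ### The linearised problem -/

section Linearised

variable {γ : ℝ → ℝ} {h lam : ℝ}

theorem IsVorticityFunction.continuousOn_potential (hγ : IsVorticityFunction γ) (hh : 0 < h) :
    ContinuousOn (fun y => deriv γ (trivialSolution γ h lam y)) (Icc (-h) 0) :=
  (hγ.contDiff.continuous_deriv (by norm_num)).comp_continuousOn
    (trivialSolution_spec hγ hh lam).1.1.continuousOn

theorem IsVorticityFunction.deriv_le_iSup (hγ : IsVorticityFunction γ) (x : ℝ) :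
    deriv γ x ≤ ⨆ t, deriv γ t := by
  obtain ⟨M, hM⟩ := hγ.bounded_deriv
  exact le_ciSup ⟨M, by rintro _ ⟨t, rfl⟩; exact (abs_le.1 (hM t)).2⟩ x

theorem SolvesLinearised.hasContDerivOn (hγ : IsVorticityFunction γ) (hh : 0 < h) {μ : ℝ}
    {u : ℝ → ℝ} (hu : SolvesLinearised γ h lam μ u) :
    HasContDerivOn h u (derivWithin u (Icc (-h) 0)) ∧
      HasContDerivOn h (derivWithin u (Icc (-h) 0))
        (fun y => -((deriv γ (trivialSolution γ h lam y) + μ) * u y)) := by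
  have hq := hγ.continuousOn_potential (lam := lam) hh
  have hc := hu.1.continuousOn
  exact ⟨⟨fun t ht => (hu.1 t ht).hasDerivWithinAt, fun t ht => (hu.2 t ht).continuousWithinAt⟩,
    hu.2, by fun_prop⟩

/-- An eigenfunction would have zero energy for the potential `γ'(ψ) + μ`, against coercivity. -/
theorem notMem_dirichletSpectrum (hγ : IsVorticityFunction γ) (hh : 0 < h) {μ : ℝ}
    (hμ : (⨆ t, deriv γ t) + μ < Real.pi ^ 2 / h ^ 2) : μ ∉ dirichletSpectrum γ h lam := by
  rintro ⟨u, hu, u1, u0, hne⟩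
  obtain ⟨h1, h2⟩ := hu.hasContDerivOn hγ hh
  have hp := (hγ.continuousOn_potential (lam := lam) hh).fun_add (continuousOn_const (c := μ))
  have e1 := energy_eq_of_solution hh hp h1 h2
  have e2 := h1.le_energy hh hp u1 u0 (c := (⨆ t, deriv γ t) + μ)
    fun y _ => by simpa using hγ.deriv_le_iSup _
  have e3 := mul_pos (sub_pos.2 hμ) (integral_sq_pos hh h1.continuousOn hne)
  rw [u1, u0] at e1
  linarith

/-! ### The slope as a minimum of affine functions of `μ`. -/

/-- The slope `β_y^{μ,lam}(0)`. -/
noncomputable def betaSlope (γ : ℝ → ℝ) (h lam μ : ℝ) : ℝ :=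
  derivWithin (beta γ h lam μ) (Icc (-h) 0) 0

/-- Up to the energy of `u - β^{μ,lam}`, the slope `β_y^{μ,lam}(0)` is the energy of any `u` with
the boundary values of `β^{μ,lam}`. -/
theorem betaSlope_le_energy (hγ : IsVorticityFunction γ) (hh : 0 < h) {μ : ℝ}
    (hμ : μ ∉ dirichletSpectrum γ h lam) {u u' : ℝ → ℝ} (hu : HasContDerivOn h u u')
    (u1 : u (-h) = 0) (u0 : u 0 = 1) :
    betaSlope γ h lam μ + (Real.pi ^ 2 / h ^ 2 - ((⨆ t, deriv γ t) + μ)) *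
        (∫ y in (-h)..0, (u y - beta γ h lam μ y) ^ 2) ≤
      energy h (fun y => deriv γ (trivialSolution γ h lam y)) u u'
        - μ * ∫ y in (-h)..0, u y ^ 2 := by
  have hq := hγ.continuousOn_potential (lam := lam) hh
  have hp := hq.fun_add (continuousOn_const (c := μ))
  obtain ⟨hβ, b1, b0⟩ := beta_spec hγ hh hμ
  obtain ⟨h1, h2⟩ := hβ.hasContDerivOn hγ hh
  have e1 := energy_eq_add_energy_sub hh hp h1 h2 hu (by rw [u1, b1]) (by rw [u0, b0])
  have e2 := (hu.sub h1).le_energy hh hp (by simp [u1, b1]) (by simp [u0, b0])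
    (c := (⨆ t, deriv γ t) + μ) fun y _ => by simpa using hγ.deriv_le_iSup _
  have e3 := hu.energy_add_const hh hq μ
  rw [b0, b1] at e1
  rw [betaSlope, ← e3]
  linarith

/-- The case of equality in the variational bound: the minimum is attained at `β` itself. -/
theorem betaSlope_eq_energy (hγ : IsVorticityFunction γ) (hh : 0 < h) {μ : ℝ}
    (hμ : μ ∉ dirichletSpectrum γ h lam) :
    betaSlope γ h lam μ = energy h (fun y => deriv γ (trivialSolution γ h lam y))
      (beta γ h lam μ) (derivWithin (beta γ h lam μ) (Icc (-h) 0))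
        - μ * ∫ y in (-h)..0, beta γ h lam μ y ^ 2 := by
  have hq := hγ.continuousOn_potential (lam := lam) hh
  have hp := hq.fun_add (continuousOn_const (c := μ))
  obtain ⟨hβ, b1, b0⟩ := beta_spec hγ hh hμ
  obtain ⟨h1, h2⟩ := hβ.hasContDerivOn hγ hh
  have e1 := energy_eq_of_solution hh hp h1 h2
  have e3 := h1.energy_add_const hh hq μ
  rw [b0, b1] at e1
  rw [betaSlope, ← e3]
  linarith

/-- If the two functions agreed, so would their second derivatives at `0`; both functions equal `1`
there, so the equation would force `μ = κ`. This is the source of strictness in the concavity. -/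
theorem exists_beta_ne (hγ : IsVorticityFunction γ) (hh : 0 < h) {μ κ : ℝ} (hne : μ ≠ κ)
    (hμ : μ ∉ dirichletSpectrum γ h lam) (hκ : κ ∉ dirichletSpectrum γ h lam) :
    ∃ y ∈ Icc (-h) 0, beta γ h lam μ y - beta γ h lam κ y ≠ 0 := by
  by_contra! hcon
  obtain ⟨hβ, b1, b0⟩ := beta_spec hγ hh hμ
  obtain ⟨hβ', b1', b0'⟩ := beta_spec hγ hh hκ
  have hud := uniqueDiffOn_Icc (by linarith : -h < 0)
  have hm : (0 : ℝ) ∈ Icc (-h) 0 := ⟨by linarith, le_rfl⟩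
  have heq : EqOn (beta γ h lam μ) (beta γ h lam κ) (Icc (-h) 0) :=
    fun y hy => sub_eq_zero.1 (hcon y hy)
  have hd : EqOn (derivWithin (beta γ h lam μ) (Icc (-h) 0))
      (derivWithin (beta γ h lam κ) (Icc (-h) 0)) (Icc (-h) 0) :=
    fun y hy => derivWithin_congr heq (heq hy)
  have e1 := (hβ.2 0 hm).derivWithin (hud 0 hm)
  have e2 := (hβ'.2 0 hm).derivWithin (hud 0 hm)
  rw [derivWithin_congr hd (hd hm), e2, b0, b0'] at e1
  apply hne
  linarith

/-- Strict concavity of `μ ↦ β_y^{μ,lam}(0)` on the nonpositive half line. -/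
theorem betaSlope_strictConcave (hγ : IsVorticityFunction γ) (hh : 0 < h)
    (hs : (⨆ t, deriv γ t) ≤ Real.pi ^ 2 / h ^ 2) {a b c : ℝ} (hab : a < b) (hbc : b < c)
    (hc0 : c ≤ 0) (ha : a ∉ dirichletSpectrum γ h lam) (hb : b ∉ dirichletSpectrum γ h lam)
    (hc : c ∉ dirichletSpectrum γ h lam) :
    (c - b) * betaSlope γ h lam a + (b - a) * betaSlope γ h lam c <
      (c - a) * betaSlope γ h lam b := by
  obtain ⟨hβ, b1, b0⟩ := beta_spec hγ hh hb
  have hu := (hβ.hasContDerivOn hγ hh).1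
  have hva := ((beta_spec hγ hh ha).1.hasContDerivOn hγ hh).1
  -- The function `β^b` is the test function at `a` and at `c`. The resulting bounds are values of
  -- one affine function of `μ`, which meets the slope at `μ = b`.
  have e0 := betaSlope_eq_energy hγ hh hb
  have e1 := betaSlope_le_energy hγ hh ha hu b1 b0
  have e2 := betaSlope_le_energy hγ hh hc hu b1 b0
  -- Strictness is available at `a < 0` only: at `c = 0` the coefficient vanishes when `sup γ' =
  -- π²/h²`.
  have e3 : 0 < (Real.pi ^ 2 / h ^ 2 - ((⨆ t, deriv γ t) + a)) *
      (∫ y in (-h)..0, (beta γ h lam b y - beta γ h lam a y) ^ 2) :=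
    mul_pos (by linarith) (integral_sq_pos hh (hu.sub hva).continuousOn
      (exists_beta_ne hγ hh hab.ne' hb ha))
  have e4 : 0 ≤ (Real.pi ^ 2 / h ^ 2 - ((⨆ t, deriv γ t) + c)) *
      (∫ y in (-h)..0, (beta γ h lam b y - beta γ h lam c y) ^ 2) :=
    mul_nonneg (by linarith) (integral_sq_nonneg hh _)
  set I := ∫ y in (-h)..0, beta γ h lam b y ^ 2
  have f1 : betaSlope γ h lam a < betaSlope γ h lam b + (b - a) * I := by linarith
  have f2 : betaSlope γ h lam c ≤ betaSlope γ h lam b - (c - b) * I := by linarith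
  have g1 := mul_lt_mul_of_pos_left f1 (sub_pos.2 hbc)
  have g2 := mul_le_mul_of_nonneg_left f2 (sub_pos.2 hab).le
  linarith

theorem threshold_le_betaSlope (hγ : IsVorticityFunction γ) (hh : 0 < h)
    (hs : (⨆ t, deriv γ t) < Real.pi ^ 2 / h ^ 2) :
    threshold h (⨆ t, deriv γ t) ≤ betaSlope γ h lam 0 := by
  have hq := (hγ.continuousOn_potential (lam := lam) hh).fun_add (continuousOn_const (c := 0))
  obtain ⟨hβ, b1, b0⟩ := beta_spec hγ hh (notMem_dirichletSpectrum (lam := lam) hγ hh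
    (μ := 0) (by simpa using hs))
  obtain ⟨h1, h2⟩ := hβ.hasContDerivOn hγ hh
  exact threshold_le hh (b' := derivWithin (beta γ h lam 0) (Icc (-h) 0)) hq
    (fun y _ => by simpa using hγ.deriv_le_iSup _) hs h1 h2 b1 b0

/-- `β_y^{μ,lam}(0)` grows sublinearly as `μ → -∞`. -/
theorem exists_betaSlope_le (hγ : IsVorticityFunction γ) (hh : 0 < h)
    (hs : (⨆ t, deriv γ t) ≤ Real.pi ^ 2 / h ^ 2) {ε : ℝ} (hε : 0 < ε) :
    ∃ C : ℝ, ∀ μ < 0, betaSlope γ h lam μ ≤ C - ε * μ := by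
  -- The test function is `(1 + y/h)^n`. Its square integrates to `h/(2n+1)`, which is at most `ε`
  -- for this `n`, and its energy is the constant `C`.
  obtain ⟨n, hn⟩ := exists_nat_gt (h / ε)
  have hn0 : (0 : ℝ) < n := lt_trans (by positivity) hn
  have hnn : n ≠ 0 := by rintro rfl; simp at hn0
  have hd : ∀ (m : ℕ) (t : ℝ), HasDerivAt (fun y : ℝ => (1 + y / h) ^ m)
      (m * (1 + t / h) ^ (m - 1) * (1 / h)) t := fun m t =>
    (((hasDerivAt_id t).div_const h).const_add 1).pow m
  have hu := hasContDerivOn_of_hasDerivAt (h := h) (hd n) (by fun_prop)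
  have u1 : (1 + -h / h) ^ n = 0 := by rw [neg_div, div_self hh.ne']; simp [hnn]
  have u0 : (1 + 0 / h) ^ n = 1 := by simp
  have hI : ∫ y in (-h)..0, ((1 + y / h) ^ n) ^ 2 ≤ ε := by
    have hv := hasContDerivOn_of_hasDerivAt (h := h) (hd (2 * n + 1)) (by fun_prop)
    have := hv.integral_eq hh
    simp only [Nat.add_sub_cancel, neg_div, div_self hh.ne'] at this
    have e : ∀ y : ℝ, ((1 + y / h) ^ n) ^ 2 = h / (2 * n + 1) *
        (((2 * n + 1 : ℕ) : ℝ) * (1 + y / h) ^ (2 * n) * (1 / h)) := by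
      intro y
      rw [← pow_mul, mul_comm n 2]
      push_cast
      field_simp
    simp only [e]
    rw [intervalIntegral.integral_const_mul, this]
    have : h / (2 * n + 1) ≤ ε := by
      rw [div_lt_iff₀ hε] at hn
      rw [div_le_iff₀ (by positivity)]
      nlinarith
    simpa using this
  refine ⟨energy h (fun y => deriv γ (trivialSolution γ h lam y)) (fun y => (1 + y / h) ^ n)
    (fun t => n * (1 + t / h) ^ (n - 1) * (1 / h)), fun μ hμ => ?_⟩
  have e1 := betaSlope_le_energy hγ hh (notMem_dirichletSpectrum (lam := lam) hγ hh
    (μ := μ) (by linarith)) hu u1 u0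
  have e2 : 0 ≤ (Real.pi ^ 2 / h ^ 2 - ((⨆ t, deriv γ t) + μ)) *
      (∫ y in (-h)..0, ((1 + y / h) ^ n - beta γ h lam μ y) ^ 2) :=
    mul_nonneg (by linarith) (integral_sq_nonneg hh _)
  have e3 := mul_le_mul_of_nonneg_left hI (neg_pos.2 hμ).le
  refine (le_of_add_le_of_nonneg_left e1 e2).trans ?_
  linarith

end Linearised

/-! ### The dispersion relation -/

theorem encard_le_two_of_forall_lt {S : Set ℝ}
    (hS : ∀ a ∈ S, ∀ b ∈ S, ∀ c ∈ S, a < b → b < c → False) : S.encard ≤ 2 := by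
  by_contra! hlt
  have h3 : (3 : ℕ∞) ≤ S.encard := by
    have := Order.add_one_le_of_lt hlt
    norm_num at this
    exact this
  obtain ⟨t, hts, ht⟩ := Set.exists_subset_encard_eq h3
  obtain ⟨x, y, z, hxy, hxz, hyz, rfl⟩ := Set.encard_eq_three.1 ht
  have hx : x ∈ S := hts (by simp)
  have hy : y ∈ S := hts (by simp)
  have hz : z ∈ S := hts (by simp)
  grind

section Dispersion

variable {γ : ℝ → ℝ} {h g σ lam : ℝ}

/-- The value of the dispersion function off the Dirichlet spectrum. -/
noncomputable def dispersionReal (γ : ℝ → ℝ) (h g σ lam μ : ℝ) : ℝ :=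
  betaSlope γ h lam μ + σ * (lam ^ 2)⁻¹ * μ + lam⁻¹ * γ 0 - (lam ^ 2)⁻¹ * g

theorem dispersion_eq_zero_iff {μ : ℝ} : dispersion γ h g σ μ lam = 0 ↔
    μ ∉ dirichletSpectrum γ h lam ∧ dispersionReal γ h g σ lam μ = 0 := by
  unfold dispersion
  split_ifs with hμ
  · simp [hμ]
  · rw [WithTop.coe_eq_zero]
    exact ⟨fun H => ⟨hμ, H⟩, fun H => H.2⟩

theorem dispersionReal_strictConcave (hγ : IsVorticityFunction γ) (hh : 0 < h)
    (hs : (⨆ t, deriv γ t) ≤ Real.pi ^ 2 / h ^ 2) {a b c : ℝ} (hab : a < b) (hbc : b < c)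
    (hc0 : c ≤ 0) (ha : a ∉ dirichletSpectrum γ h lam) (hb : b ∉ dirichletSpectrum γ h lam)
    (hc : c ∉ dirichletSpectrum γ h lam) :
    (c - b) * dispersionReal γ h g σ lam a + (b - a) * dispersionReal γ h g σ lam c <
      (c - a) * dispersionReal γ h g σ lam b := by
  have := betaSlope_strictConcave hγ hh hs hab hbc hc0 ha hb hc
  unfold dispersionReal
  linarith

/-- Three zeros would turn the strict three-point inequality into `0 < 0`. That form needs only the
three points to lie off the spectrum, so it does not matter that `0` may be an eigenvalue when `sup
γ' = π²/h²`. -/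
theorem encard_dispersion_zeros_le_two (hγ : IsVorticityFunction γ) (hh : 0 < h)
    (hs : (⨆ t, deriv γ t) ≤ Real.pi ^ 2 / h ^ 2) :
    {μ : ℝ | μ ≤ 0 ∧ dispersion γ h g σ μ lam = 0}.encard ≤ 2 := by
  refine encard_le_two_of_forall_lt ?_
  simp only [mem_ofPred_eq, dispersion_eq_zero_iff]
  rintro a ⟨-, ha, ha0⟩ b ⟨-, hb, hb0⟩ c ⟨hc', hc, hc0⟩ hab hbc
  have := dispersionReal_strictConcave (g := g) (σ := σ) hγ hh hs hab hbc hc' ha hb hc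
  rw [ha0, hb0, hc0] at this
  linarith

/-- The strict bound on `sup γ'` clears the whole closed half line of eigenvalues, so concavity
holds on a genuine interval and brings continuity in its interior. -/
theorem strictConcaveOn_dispersionReal (hγ : IsVorticityFunction γ) (hh : 0 < h)
    (hs : (⨆ t, deriv γ t) < Real.pi ^ 2 / h ^ 2) :
    StrictConcaveOn ℝ (Iic 0) (dispersionReal γ h g σ lam) := by
  refine strictConcaveOn_of_slope_strict_anti_adjacent (convex_Iic 0) fun {x y z} _ hz hxy hyz => ?_
  have hz : z ≤ 0 := hz
  have hn : ∀ μ ≤ 0, μ ∉ dirichletSpectrum γ h lam := fun μ hμ =>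
    notMem_dirichletSpectrum hγ hh (by linarith)
  have := dispersionReal_strictConcave (g := g) (σ := σ) hγ hh hs.le hxy hyz hz
    (hn x (by linarith)) (hn y (by linarith)) (hn z hz)
  rw [div_lt_div_iff₀ (sub_pos.2 hyz) (sub_pos.2 hxy)]
  linarith

/-- A strictly concave function on `(-∞, 0]` which is positive at `0` and takes a negative value has
exactly one zero. -/
theorem exists_unique_zero_of_strictConcaveOn {f : ℝ → ℝ} (hf : StrictConcaveOn ℝ (Iic 0) f)
    (h0 : 0 < f 0) {a : ℝ} (ha : a < 0) (hfa : f a < 0) :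
    ∃ μ₀ < 0, f μ₀ = 0 ∧ ∀ μ < 0, f μ = 0 → μ = μ₀ := by
  have hcont : ContinuousOn f (Iio 0) := by
    have := hf.concaveOn.continuousOn_interior
    rwa [interior_Iic] at this
  -- Slopes of the chords over `[x, y]` and `[y, 0]`, cross-multiplied. Two zeros `x < y < 0` would
  -- give `f 0 * (y - x) < 0`.
  have key : ∀ {x y : ℝ}, x < y → y < 0 → f y * x + f 0 * (y - x) < f x * y := by
    intro x y hxy hy
    have := hf.slope_anti_adjacent (x := x) (y := y) (z := 0) (by simp; linarith) (by simp) hxy hy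
    rw [div_lt_div_iff₀ (by linarith) (by linarith)] at this
    linarith
  have huniq : ∀ {x y : ℝ}, x < y → y < 0 → f x = 0 → f y = 0 → False := by
    intro x y hxy hy hx hy'
    have := key hxy hy
    rw [hx, hy'] at this
    have := mul_pos h0 (sub_pos.2 hxy)
    linarith
  obtain ⟨b, hab, hb0, hfb⟩ : ∃ b, a < b ∧ b < 0 ∧ 0 < f b := by
    -- This is where the chord from `(a, f a)` to `(0, f 0)` crosses zero; strict concavity puts `f`
    -- above it. A positive value at some `b < 0` is needed because continuity is known only on the
    -- open half line.
    refine ⟨a * (f 0 / (f 0 - f a)), ?_, mul_neg_of_neg_of_pos ha (by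
      have : 0 < f 0 - f a := by linarith
      positivity), ?_⟩
    all_goals
      have hd : 0 < f 0 - f a := by linarith
    · have : f 0 / (f 0 - f a) < 1 := (div_lt_one hd).2 (by linarith)
      nlinarith
    · set r := f 0 / (f 0 - f a) with hr
      have hr0 : 0 < r := by positivity
      have hr1 : r < 1 := (div_lt_one hd).2 (by linarith)
      have hr2 : r * (f 0 - f a) = f 0 := by rw [hr]; field_simp
      have := hf.2 (x := a) (y := 0) ha.le self_mem_Iic ha.ne hr0 (sub_pos.2 hr1)
        (by ring)
      simp only [smul_eq_mul, mul_zero, add_zero] at this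
      rw [mul_comm a r]
      linarith
  obtain ⟨μ₀, hμ₀, hz⟩ := intermediate_value_Icc hab.le
    (hcont.mono fun x hx => lt_of_le_of_lt hx.2 hb0) ⟨hfa.le, hfb.le⟩
  have hneg : μ₀ < 0 := lt_of_le_of_lt hμ₀.2 hb0
  refine ⟨μ₀, hneg, hz, fun μ hμ hμz => ?_⟩
  rcases lt_trichotomy μ μ₀ with hlt | heq | hgt
  · exact (huniq hlt hneg hμz hz).elim
  · exact heq
  · exact (huniq hgt hμ hz hμz).elim

theorem exists_unique_dispersion_zero (hγ : IsVorticityFunction γ) (hh : 0 < h) (hσ : 0 < σ)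
    (hlam : lam ≠ 0) (hs : (⨆ t, deriv γ t) < Real.pi ^ 2 / h ^ 2)
    (hthr : (lam ^ 2)⁻¹ * g - lam⁻¹ * γ 0 < threshold h (⨆ t, deriv γ t)) :
    ∃ μ₀ < 0, dispersion γ h g σ μ₀ lam = 0 ∧
      ∀ μ < 0, dispersion γ h g σ μ lam = 0 → μ = μ₀ := by
  have h0 : 0 < dispersionReal γ h g σ lam 0 := by
    have := threshold_le_betaSlope (lam := lam) hγ hh hs
    unfold dispersionReal
    linarith
  have hκ : 0 < σ * (lam ^ 2)⁻¹ := by positivity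
  -- With `ε` half of `σ/lam²`, half of the linear term of `d` survives.
  obtain ⟨C, hC⟩ := exists_betaSlope_le (lam := lam) hγ hh hs.le (half_pos hκ)
  obtain ⟨a, ha, hfa⟩ : ∃ a < 0, dispersionReal γ h g σ lam a < 0 := by
    set E := |C + lam⁻¹ * γ 0 - (lam ^ 2)⁻¹ * g| + 1 with hE
    have hE0 : 0 < E := by positivity
    -- At this point the surviving half equals `-E`, which outweighs all the constants by at least
    -- `1`.
    have ha : -(2 * E / (σ * (lam ^ 2)⁻¹)) < 0 := neg_neg_of_pos (by positivity)
    refine ⟨_, ha, ?_⟩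
    have e1 := hC _ ha
    have e2 : σ * (lam ^ 2)⁻¹ * -(2 * E / (σ * (lam ^ 2)⁻¹)) = -(2 * E) := by
      rw [mul_neg, mul_div_cancel₀ _ hκ.ne']
    have e3 := le_abs_self (C + lam⁻¹ * γ 0 - (lam ^ 2)⁻¹ * g)
    unfold dispersionReal
    linarith
  obtain ⟨μ₀, hneg, hz, huniq⟩ := exists_unique_zero_of_strictConcaveOn
    (strictConcaveOn_dispersionReal (g := g) (σ := σ) (lam := lam) hγ hh hs) h0 ha hfa
  exact ⟨μ₀, hneg, dispersion_eq_zero_iff.2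
    ⟨notMem_dirichletSpectrum hγ hh (by linarith), hz⟩,
    fun μ hμ H => huniq μ hμ (dispersion_eq_zero_iff.1 H).2⟩

end Dispersion

/-- In the variable `x = 1/lam` the left side is a polynomial vanishing at `x = 0`, so continuity
there suffices. -/
theorem exists_forall_lt_of_le_abs {c : ℝ} (hc : 0 < c) (g b : ℝ) :
    ∃ Λ : ℝ, 0 < Λ ∧ ∀ lam : ℝ, Λ ≤ |lam| → (lam ^ 2)⁻¹ * g - lam⁻¹ * b < c := by
  have hcont : Continuous fun x : ℝ => x ^ 2 * g - x * b := by fun_prop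
  obtain ⟨δ, hδ, H⟩ := Metric.continuous_iff.1 hcont 0 c hc
  refine ⟨2 / δ, by positivity, fun lam hlam => ?_⟩
  have hpos : 0 < |lam| := lt_of_lt_of_le (by positivity) hlam
  have := H lam⁻¹ (by
    rw [Real.dist_eq, sub_zero, abs_inv, inv_lt_comm₀ hpos hδ]
    refine lt_of_lt_of_le ?_ hlam
    rw [inv_eq_one_div]
    gcongr
    norm_num)
  rw [Real.dist_eq] at this
  have := lt_of_le_of_lt (le_abs_self _) this
  simpa using this

end CapillaryGravity

theorem mainTheorem10 (γ : ℝ → ℝ) (hγ : CapillaryGravity.IsVorticityFunction γ)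
    (h g σ : ℝ) (hh : 0 < h) (hg : 0 < g) (hσ : 0 < σ) :
    ((⨆ t : ℝ, deriv γ t) ≤ Real.pi ^ 2 / h ^ 2 →
      ∀ lam : ℝ, lam ≠ 0 →
        {μ : ℝ | μ ≤ 0 ∧ CapillaryGravity.dispersion γ h g σ μ lam = 0}.encard ≤ 2) ∧
    ((⨆ t : ℝ, deriv γ t) < Real.pi ^ 2 / h ^ 2 →
      ∀ lam : ℝ, lam ≠ 0 →
        (lam ^ 2)⁻¹ * g - lam⁻¹ * γ 0 < CapillaryGravity.threshold h (⨆ t : ℝ, deriv γ t) →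
        ∃ μ₀ : ℝ, μ₀ < 0 ∧ CapillaryGravity.dispersion γ h g σ μ₀ lam = 0 ∧
          (∀ μ : ℝ, μ < 0 → CapillaryGravity.dispersion γ h g σ μ lam = 0 → μ = μ₀) ∧
          ∀ (k₀ : ℕ) (ν : ℝ), 1 ≤ k₀ → 0 < ν → -((k₀ : ℝ) * ν) ^ 2 = μ₀ →
            ∀ k : ℕ, 1 ≤ k →
              (CapillaryGravity.dispersion γ h g σ (-((k : ℝ) * ν) ^ 2) lam = 0 ↔ k = k₀)) ∧
    ((⨆ t : ℝ, deriv γ t) < Real.pi ^ 2 / (4 * h ^ 2) →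
      ∃ Λ : ℝ, 0 < Λ ∧ ∀ lam : ℝ, Λ ≤ |lam| →
        (lam ^ 2)⁻¹ * g - lam⁻¹ * γ 0 <
          CapillaryGravity.threshold h (⨆ t : ℝ, deriv γ t)) := by
  refine ⟨fun hs lam _ => CapillaryGravity.encard_dispersion_zeros_le_two hγ hh hs,
    fun hs lam hlam hthr => ?_, fun hs => CapillaryGravity.exists_forall_lt_of_le_abs
      (CapillaryGravity.threshold_pos hh hs) g (γ 0)⟩
  obtain ⟨μ₀, hneg, hz, huniq⟩ :=
    CapillaryGravity.exists_unique_dispersion_zero hγ hh hσ hlam hs hthr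
  refine ⟨μ₀, hneg, hz, huniq, fun k₀ ν hk₀ hν hμ₀ k hk => ⟨fun H => ?_, ?_⟩⟩
  · have hk' : (0 : ℝ) < k := by exact_mod_cast hk
    -- Since `k ≥ 1`, the number `-(kν)²` is negative and uniqueness applies; positivity of the
    -- bases then allows taking square roots.
    have e := huniq _ (neg_neg_of_pos (by positivity)) H
    rw [← hμ₀, neg_inj, sq_eq_sq₀ (by positivity) (by positivity)] at e
    exact_mod_cast mul_right_cancel₀ hν.ne' e
  · rintro rfl
    rwa [hμ₀]
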